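/- Let $d\ge 2$ be a fixed integer. There are a constant $C$ and an exponent $p\in\mathbb N$, depending only on $d$, such that for every $\kappa\ge 1$ and every $\varepsilon\in(0,1)$ there is a randomized adaptive algorithm, depending on $d,\kappa,\varepsilon$ only, with the following property. For every potential $V:\mathbb R^d\to\mathbb R$ that is $1$-strongly convex, $\kappa$-smooth (that is, differentiable with $\|\nabla V(x)-\nabla V(y)\|\le\kappa\|x-y\|$ for all $x,y$) and minimized at $0$, the algorithm makes at most $$C\left(\log\kappa+\left(\log\tfrac1\varepsilon\right)^{p}\right)$$ adaptive queries to the first-order oracle $x\mapsto(V(x),\nabla V(x))$ and outputs a random point of $\mathbb R^d$ whose law $\hat\pi$ satisfies $$\|\hat\pi-\pi\|_{\mathrm{TV}}=\sup_{A}|\hat\pi(A)-\pi(A)|\le\varepsilon,$$ where the supremum is over measurable sets $A\subseteq\mathbb R^d$ and $\pi$ is the probability measure with density $e^{-V}/\int_{\mathbb R^d}e^{-V}$ with respect to Lebesgue measure. Here a randomized adaptive algorithm draws a random seed from a probability space; each query point is a measurable function of the seed and of the oracle's answers to the previous queries, and the output is a measurable function of the seed and of all answers. -/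

import Mathlib

open MeasureTheory

noncomputable section

/-- The potential `V` on `ℝᵈ` is `1`-strongly convex, `κ`-smooth (differentiable with
`κ`-Lipschitz gradient), and minimized at the origin. -/
structure IsAdmissiblePotential {d : ℕ} (κ : ℝ) (V : EuclideanSpace ℝ (Fin d) → ℝ) : Prop where
  strongConvex : StrongConvexOn Set.univ 1 V
  differentiable : Differentiable ℝ V
  gradient_lipschitz : ∀ x y, ‖gradient V x - gradient V y‖ ≤ κ * ‖x - y‖
  minimized_at_zero : ∀ x, V 0 ≤ V x

/-- The probability measure `π ∝ exp (-V)` on `ℝᵈ`, i.e. the measure with density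
`exp (-V x) / ∫ exp (-V)` with respect to Lebesgue measure. -/
def targetMeasure {d : ℕ} (V : EuclideanSpace ℝ (Fin d) → ℝ) :
    Measure (EuclideanSpace ℝ (Fin d)) :=
  (volume : Measure (EuclideanSpace ℝ (Fin d))).tilted (fun x => -V x)

/-- The total variation distance `sup_A |μ A - ν A|`, over all measurable sets `A`
(used for probability measures only). -/
def tvDistance {α : Type*} [MeasurableSpace α] (μ ν : Measure α) : ℝ :=
  ⨆ A : {A : Set α // MeasurableSet A}, |μ.real A.1 - ν.real A.1|

/-- The answer of the first-order oracle for `V` at the query point `x`: the pair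
`(V x, ∇ V x)`. -/
def firstOrderOracle {d : ℕ} (V : EuclideanSpace ℝ (Fin d) → ℝ)
    (x : EuclideanSpace ℝ (Fin d)) : ℝ × EuclideanSpace ℝ (Fin d) :=
  (V x, gradient V x)

/-- A randomized adaptive first-order query algorithm on `ℝᵈ`. It draws a random seed `ω` once
from a probability space. Its query number `k` (counted from `0`) is a function of the seed and of
the oracle's answers to the previous `k` queries; after `numQueries` queries it outputs a point of
`ℝᵈ` that is a function of the seed and of all answers. Neither the seed nor these functions depend
on the potential, which is accessed through the oracle answers only. (The values of `query k` for
`k ≥ numQueries` are never used.) -/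
structure QueryAlgorithm (d : ℕ) where
  Seed : Type
  [measurableSpaceSeed : MeasurableSpace Seed]
  seedLaw : Measure Seed
  [isProbabilityMeasure_seedLaw : IsProbabilityMeasure seedLaw]
  numQueries : ℕ
  query : (k : ℕ) → Seed × (Fin k → ℝ × EuclideanSpace ℝ (Fin d)) → EuclideanSpace ℝ (Fin d)
  measurable_query : ∀ k, Measurable (query k)
  output : Seed × (Fin numQueries → ℝ × EuclideanSpace ℝ (Fin d)) → EuclideanSpace ℝ (Fin d)
  measurable_output : Measurable output

attribute [instance] QueryAlgorithm.measurableSpaceSeed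
  QueryAlgorithm.isProbabilityMeasure_seedLaw

namespace QueryAlgorithm

/-- The oracle's answers to the first `k` queries when the algorithm is run on the potential `V`
with seed `ω`. -/
def answers {d : ℕ} (alg : QueryAlgorithm d) (V : EuclideanSpace ℝ (Fin d) → ℝ)
    (ω : alg.Seed) : (k : ℕ) → (Fin k → ℝ × EuclideanSpace ℝ (Fin d))
  | 0 => Fin.elim0
  | k + 1 => Fin.snoc (α := fun _ => ℝ × EuclideanSpace ℝ (Fin d)) (alg.answers V ω k)
      (firstOrderOracle V (alg.query k (ω, alg.answers V ω k)))

/-- The point that the algorithm outputs when it is run on the potential `V` with seed `ω`. -/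
def run {d : ℕ} (alg : QueryAlgorithm d) (V : EuclideanSpace ℝ (Fin d) → ℝ)
    (ω : alg.Seed) : EuclideanSpace ℝ (Fin d) :=
  alg.output (ω, alg.answers V ω alg.numQueries)

/-- The law of the output of the algorithm when it is run on the potential `V`. -/
def outputLaw {d : ℕ} (alg : QueryAlgorithm d) (V : EuclideanSpace ℝ (Fin d) → ℝ) :
    Measure (EuclideanSpace ℝ (Fin d)) :=
  alg.seedLaw.map (alg.run V)

end QueryAlgorithm

end

/-! The dependence on `κ` is removed by rounding a single sublevel set. After that, rejection
sampling has an acceptance probability that depends only on `d`.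

Let `K = {V ≤ V 0 + 1}`. One query at the origin reveals `V 0`. Strong convexity puts `K` inside the
ball of radius `2`, and smoothness puts the ball of radius `κ^(-1/2)` inside `K`. Keep an ellipsoid
`c + A • ball ⊇ K` and test the vertices of a small cross-polytope in its coordinates. If one of
them is outside `K`, the gradient there cuts off part of the ellipsoid, and the rest fits in an
ellipsoid smaller in volume by the factor `cutContraction d < 1` (`sublevel_subset_ellipsoid_cut`).
Volumes stay between multiples `κ^(-d/2)` and `2^d` of the unit ball, so `O(log κ)` cuts suffice
(`isRounding_roundingState`). Once all vertices are in `K`, convexity puts a ball of radius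
depending only on `d` into `K`, in these coordinates.

In rounded coordinates `V - V 0` grows linearly (`IsRounding.norm_div_sub_le`), so the fixed law
with density proportional to `exp (-‖u‖ / 3)` dominates the target up to a constant. Its proposals
are accepted with probability at least `acceptBound d`, and `O(log (1/ε))` trials leave an error of
at most `ε`. Thus `p = 1` works.

The bound has no additive constant. When `κ ≤ 2` and `ε` is close to `1` the budget may be below one
query, and a fixed Gaussian output serves (`exists_tvDistance_noQueryAlgorithm_le`). -/

open scoped InnerProductSpace RealInnerProductSpace

/-! ### Quadratic bounds on admissible potentials -/

/-- The tangent plane of a convex function lies below the function. -/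
theorem ConvexOn.add_inner_gradient_le {E : Type*} [NormedAddCommGroup E] [InnerProductSpace ℝ E]
    [CompleteSpace E] {f : E → ℝ} (hf : ConvexOn ℝ Set.univ f) {x : E}
    (hx : DifferentiableAt ℝ f x) (y : E) : f x + ⟪gradient f x, y - x⟫_ℝ ≤ f y := by
  have hline : ConvexOn ℝ Set.univ (f ∘ AffineMap.lineMap (k := ℝ) x y) := by
    simpa using hf.comp_affineMap (AffineMap.lineMap (k := ℝ) x y)
  have hderiv : HasDerivAt (f ∘ AffineMap.lineMap (k := ℝ) x y) ⟪gradient f x, y - x⟫_ℝ 0 := by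
    have h1 : HasFDerivAt f (InnerProductSpace.toDual ℝ E (gradient f x))
        (AffineMap.lineMap (k := ℝ) x y 0) := by
      simpa using hx.hasGradientAt.hasFDerivAt
    have h2 : HasDerivAt (AffineMap.lineMap (k := ℝ) x y) (y - x) (0 : ℝ) := by
      simpa using AffineMap.hasDerivAt_lineMap (a := x) (b := y) (x := (0 : ℝ))
    simpa using h1.comp_hasDerivAt (0 : ℝ) h2
  have h := hline.le_slope_of_hasDerivAt (Set.mem_univ (0 : ℝ)) (Set.mem_univ (1 : ℝ))
    zero_lt_one hderiv
  simp only [slope_def_field, Function.comp_apply, AffineMap.lineMap_apply_zero,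
    AffineMap.lineMap_apply_one, sub_zero, div_one] at h
  linarith

namespace IsAdmissiblePotential

variable {d : ℕ} {κ : ℝ} {V : EuclideanSpace ℝ (Fin d) → ℝ}

theorem convexOn (hV : IsAdmissiblePotential κ V) : ConvexOn ℝ Set.univ V :=
  strongConvexOn_zero.1 (hV.strongConvex.mono zero_le_one)

theorem continuous (hV : IsAdmissiblePotential κ V) : Continuous V :=
  hV.differentiable.continuous

theorem continuous_gradient (hV : IsAdmissiblePotential κ V) : Continuous (gradient V) := by
  have : LipschitzWith κ.toNNReal (gradient V) := by
    refine LipschitzWith.of_dist_le_mul fun x y => ?_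
    rw [dist_eq_norm, dist_eq_norm]
    exact (hV.gradient_lipschitz x y).trans
      (mul_le_mul_of_nonneg_right (Real.le_coe_toNNReal κ) (norm_nonneg _))
  exact this.continuous

theorem gradient_zero (hV : IsAdmissiblePotential κ V) : gradient V 0 = 0 := by
  have : IsLocalMin V 0 := Filter.Eventually.of_forall hV.minimized_at_zero
  simp [gradient, this.fderiv_eq_zero]

/-- The tangent plane at `x`, evaluated at `0`, gives `V x - V 0 ≤ ⟪∇V x, x⟫`, and `‖∇V x‖ ≤ κ ‖x‖`
since the gradient vanishes at `0`. Losing the factor `1/2` avoids integrating along a segment. -/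
theorem sub_le (hV : IsAdmissiblePotential κ V) (x : EuclideanSpace ℝ (Fin d)) :
    V x - V 0 ≤ κ * ‖x‖ ^ 2 := by
  have h1 := hV.convexOn.add_inner_gradient_le (hV.differentiable x) 0
  have h2 := hV.gradient_lipschitz x 0
  rw [hV.gradient_zero, sub_zero, sub_zero] at h2
  have h3 := real_inner_le_norm (gradient V x) x
  rw [zero_sub, inner_neg_right] at h1
  nlinarith [mul_le_mul_of_nonneg_right h2 (norm_nonneg x)]

/-- Apply strong convexity on the segment from `0` to `x`, use minimality of `V 0` at the point `t •
x`, divide by `t`, and let `t → 0`. -/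
theorem le_sub (hV : IsAdmissiblePotential κ V) (x : EuclideanSpace ℝ (Fin d)) :
    ‖x‖ ^ 2 / 2 ≤ V x - V 0 := by
  have key : ∀ t : ℝ, 0 < t → t < 1 → (1 - t) * (‖x‖ ^ 2 / 2) ≤ V x - V 0 := by
    intro t h0 h1
    have h := hV.strongConvex.2 (Set.mem_univ x) (Set.mem_univ 0) h0.le (sub_pos.2 h1).le
      (by ring)
    have h2 := hV.minimized_at_zero (t • x + (1 - t) • 0)
    simp only [smul_eq_mul, sub_zero] at h
    have h3 : t * ((1 - t) * (‖x‖ ^ 2 / 2)) ≤ t * (V x - V 0) := by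
      simp only [smul_zero, add_zero] at h h2
      linarith
    exact le_of_mul_le_mul_left h3 h0
  have lim : Filter.Tendsto (fun t : ℝ => (1 - t) * (‖x‖ ^ 2 / 2)) (nhdsWithin 0 (Set.Ioi 0))
      (nhds ((1 - 0) * (‖x‖ ^ 2 / 2))) :=
    ((Continuous.tendsto (by fun_prop) 0).mono_left nhdsWithin_le_nhds)
  rw [sub_zero, one_mul] at lim
  refine le_of_tendsto lim ?_
  filter_upwards [Ioo_mem_nhdsGT (zero_lt_one' ℝ)] with t ht using key t ht.1 ht.2

end IsAdmissiblePotential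

/-! ### Total variation distance -/

/-- A one-sided multiplicative comparison of probability measures bounds their total variation
distance. -/
theorem tvDistance_le_of_mul_le {α : Type*} [MeasurableSpace α] {μ ν : Measure α}
    [IsProbabilityMeasure μ] [IsProbabilityMeasure ν] {b : ℝ}
    (h : ∀ S, MeasurableSet S → (1 - b) * ν.real S ≤ μ.real S) : tvDistance μ ν ≤ b := by
  have hb : 0 ≤ b := by
    have := h Set.univ MeasurableSet.univ
    rw [probReal_univ, probReal_univ] at this
    linarith
  have key : ∀ S, MeasurableSet S → ν.real S - μ.real S ≤ b := fun S hS => by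
    nlinarith [h S hS, measureReal_le_one (μ := ν) (s := S)]
  refine Real.iSup_le (fun A => abs_le.2 ⟨?_, ?_⟩) hb
  · linarith [key A.1 A.2]
  -- The opposite sign is the same bound for the complement.
  · have := key _ A.2.compl
    rw [probReal_compl_eq_one_sub A.2, probReal_compl_eq_one_sub A.2] at this
    linarith

theorem tvDistance_comm {α : Type*} [MeasurableSpace α] (μ ν : Measure α) :
    tvDistance μ ν = tvDistance ν μ := by
  simp only [tvDistance, abs_sub_comm]

/-! ### Shallow cuts of ellipsoids -/

noncomputable section ShallowCut

/-- The depth of the cuts in the shallow-cut ellipsoid method. -/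
def cutDepth (d : ℕ) : ℝ := 1 / (2 * d)

/-- The ratio of the semi-axes of the ellipsoid around a shallow cap of the unit ball. -/
def cutRatio (d : ℕ) : ℝ := 1 + 1 / (4 * d)

/-- The long semi-axis of the ellipsoid around a shallow cap of the unit ball. -/
def cutScale (d : ℕ) : ℝ := 1 + 3 / (16 * d ^ 2)

/-- The displacement of the center of the ellipsoid around a shallow cap of the unit ball. -/
def cutShift (d : ℕ) : ℝ :=
  (cutRatio d ^ 2 - 1) * (1 - cutDepth d) / (2 * cutRatio d ^ 2)

/-- The factor by which a shallow cut shrinks the volume. -/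
def cutContraction (d : ℕ) : ℝ := cutScale d ^ d / cutRatio d

theorem one_le_cutRatio (d : ℕ) : 1 ≤ cutRatio d := by
  unfold cutRatio; linarith [show (0 : ℝ) ≤ 1 / (4 * d) by positivity]

theorem cutRatio_pos (d : ℕ) : 0 < cutRatio d := zero_lt_one.trans_le (one_le_cutRatio d)

theorem cutScale_pos (d : ℕ) : 0 < cutScale d := by unfold cutScale; positivity

theorem cutContraction_pos (d : ℕ) : 0 < cutContraction d :=
  div_pos (pow_pos (cutScale_pos d) d) (cutRatio_pos d)

/-- With `x = 1/d`, the `d` stretched directions cost at most `exp (3x/16)`, while the compressed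
one gains `1 + x/4`. -/
theorem cutContraction_lt_one {d : ℕ} (hd : 2 ≤ d) : cutContraction d < 1 := by
  have hd' : (2 : ℝ) ≤ d := by exact_mod_cast hd
  have hpos : (0 : ℝ) < d := by linarith
  rw [cutContraction, div_lt_one (cutRatio_pos d)]
  have h1 : cutScale d ^ d ≤ Real.exp (3 / (16 * d)) := by
    calc cutScale d ^ d ≤ Real.exp (3 / (16 * d ^ 2)) ^ d := by
          refine pow_le_pow_left₀ (cutScale_pos d).le ?_ d
          rw [cutScale, add_comm]; exact Real.add_one_le_exp _
      _ = Real.exp (3 / (16 * d)) := by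
          rw [← Real.exp_nat_mul]; congr 1; field_simp
  refine h1.trans_lt ?_
  set x : ℝ := 1 / d with hx
  have hx0 : 0 < x := by positivity
  have hx1 : x ≤ 1 / 2 := one_div_le_one_div_of_le two_pos hd'
  have e1 : (3 : ℝ) / (16 * d) = 3 / 16 * x := by rw [hx]; field_simp
  have e2 : cutRatio d = 1 + x / 4 := by rw [hx, cutRatio]; field_simp
  rw [e1, e2]
  have h2 := Real.add_one_le_exp (-(3 / 16 * x))
  have h3 : Real.exp (3 / 16 * x) * Real.exp (-(3 / 16 * x)) = 1 := by
    rw [← Real.exp_add]; simp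
  nlinarith [Real.exp_pos (3 / 16 * x), Real.exp_pos (-(3 / 16 * x)), mul_pos hx0 hx0]

/-- The left side is the bound on the squared norm that arises in `exists_of_mem_cap`. To second
order in `x = 1/d` it is `1 + 5x²/16`, against `1 + 6x²/16` on the right. -/
theorem cutScale_sq_ge {d : ℕ} (hd : 2 ≤ d) :
    1 + (cutRatio d ^ 2 - 1) * cutDepth d + (cutRatio d ^ 2 - 1) ^ 2 / 4 ≤ cutScale d ^ 2 := by
  have hd' : (2 : ℝ) ≤ d := by exact_mod_cast hd
  have hpos : (0 : ℝ) < d := by linarith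
  set x : ℝ := 1 / d with hx
  have hx0 : 0 < x := by positivity
  have hx1 : x ≤ 1 / 2 := one_div_le_one_div_of_le two_pos hd'
  have e1 : cutDepth d = x / 2 := by rw [hx, cutDepth]; field_simp
  have e2 : cutRatio d = 1 + x / 4 := by rw [hx, cutRatio]; field_simp
  have e3 : cutScale d = 1 + 3 / 16 * x ^ 2 := by rw [hx, cutScale]; field_simp
  rw [e1, e2, e3]
  have h2 : x ^ 2 * x ≤ x ^ 2 * (1 / 2) := mul_le_mul_of_nonneg_left hx1 (sq_nonneg x)
  have h3 : x ^ 2 * x ^ 2 ≤ x ^ 2 * (1 / 4) :=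
    mul_le_mul_of_nonneg_left (by nlinarith) (sq_nonneg x)
  nlinarith [sq_nonneg x, sq_nonneg (x ^ 2)]

variable {E : Type*} [NormedAddCommGroup E] [InnerProductSpace ℝ E]

/-- The linear map that multiplies the component along the unit vector `a` by `t` and fixes the
orthogonal complement. -/
def axisScale (t : ℝ) (a : E) : E →L[ℝ] E :=
  ContinuousLinearMap.id ℝ E + (t - 1) • (innerSL ℝ a).smulRight a

theorem axisScale_apply (t : ℝ) (a v : E) :
    axisScale t a v = v + ((t - 1) * ⟪a, v⟫_ℝ) • a := by
  simp [axisScale, smul_smul]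

theorem axisScale_axisScale {t s : ℝ} (hts : t * s = 1) {a : E} (ha : ‖a‖ = 1) (v : E) :
    axisScale t a (axisScale s a v) = v := by
  have haa : ⟪a, a⟫_ℝ = 1 := by rw [real_inner_self_eq_norm_sq, ha, one_pow]
  simp only [axisScale_apply, inner_add_right, inner_smul_right, haa]
  rw [add_assoc, ← add_smul]
  have : (s - 1) * ⟪a, v⟫_ℝ + (t - 1) * (⟪a, v⟫_ℝ + (s - 1) * ⟪a, v⟫_ℝ * 1) = 0 := by
    linear_combination ⟪a, v⟫_ℝ * hts
  rw [this, zero_smul, add_zero]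

theorem det_axisScale [FiniteDimensional ℝ E] (t : ℝ) {a : E} (ha : ‖a‖ = 1) :
    LinearMap.det (axisScale t a : E →ₗ[ℝ] E) = t := by
  have : (axisScale t a : E →ₗ[ℝ] E) =
      LinearMap.transvection (innerSL ℝ a : E →ₗ[ℝ] ℝ) ((t - 1) • a) := by
    ext v
    simp [axisScale_apply, LinearMap.transvection.apply, smul_smul, mul_comm]
  rw [this, LinearMap.transvection.det]
  simp [ha]

/-- A shallow cap of the unit ball lies in an ellipsoid of smaller volume. -/
theorem exists_of_mem_cap {d : ℕ} (hd : 2 ≤ d) {a v : E} (ha : ‖a‖ = 1) (hv : ‖v‖ ≤ 1)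
    (hcut : ⟪a, v⟫_ℝ ≤ cutDepth d) :
    ∃ w : E, ‖w‖ ≤ 1 ∧
      v = -(cutShift d • a) + cutScale d • axisScale (cutRatio d)⁻¹ a w := by
  have hs := cutRatio_pos d
  have hρ := cutScale_pos d
  refine ⟨(cutScale d)⁻¹ • axisScale (cutRatio d) a (v + cutShift d • a), ?_, ?_⟩
  · rw [norm_smul, norm_inv, Real.norm_of_nonneg hρ.le, inv_mul_le_iff₀ hρ, mul_one]
    refine abs_le_of_sq_le_sq' ?_ hρ.le |>.2
    refine le_trans ?_ (cutScale_sq_ge hd)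
    have haa : ⟪a, a⟫_ℝ = 1 := by rw [real_inner_self_eq_norm_sq, ha, one_pow]
    have hin : -1 ≤ ⟪a, v⟫_ℝ := by
      have := (abs_le.1 (abs_real_inner_le_norm a v)).1
      rw [ha, one_mul] at this; linarith
    have hexp : ‖axisScale (cutRatio d) a (v + cutShift d • a)‖ ^ 2 =
        ‖v‖ ^ 2 - ⟪a, v⟫_ℝ ^ 2 + cutRatio d ^ 2 * (⟪a, v⟫_ℝ + cutShift d) ^ 2 := by
      rw [axisScale_apply, inner_add_right, inner_smul_right, haa, add_assoc, ← add_smul,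
        norm_add_sq_real, inner_smul_right, norm_smul, ha, mul_pow, one_pow,
        Real.norm_eq_abs, sq_abs,
        real_inner_comm a v]
      ring
    rw [hexp]
    set s := cutRatio d
    set r := cutDepth d with hr
    have hshift : s ^ 2 * cutShift d = (s ^ 2 - 1) * (1 - r) / 2 := by
      rw [cutShift]; change s ^ 2 * ((s ^ 2 - 1) * (1 - r) / (2 * s ^ 2)) = _; field_simp
    have hr0 : 0 ≤ r := by rw [hr, cutDepth]; positivity
    have hr1 : r ≤ 1 := by
      rw [hr, cutDepth, div_le_one (by positivity)]
      have : (2 : ℝ) ≤ d := by exact_mod_cast hd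
      linarith
    have hl : 0 ≤ s ^ 2 - 1 := by nlinarith [one_le_cutRatio d]
    have hsq : s ^ 2 * cutShift d ^ 2 ≤ (s ^ 2 - 1) ^ 2 / 4 := by
      have h1 : cutShift d ≤ (s ^ 2 - 1) / 2 := by
        have h0 : 0 ≤ (s ^ 2 - 1) * (1 - r) / (2 * s ^ 2) :=
          div_nonneg (mul_nonneg hl (by linarith)) (by positivity)
        have : 0 ≤ cutShift d := h0
        nlinarith
      have h0 : 0 ≤ cutShift d :=
        div_nonneg (mul_nonneg hl (by linarith)) (by positivity)
      have h2 : s ^ 2 * cutShift d ≤ (s ^ 2 - 1) / 2 := by rw [hshift]; nlinarith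
      nlinarith
    have hv2 : ‖v‖ ^ 2 ≤ 1 := by nlinarith [norm_nonneg v]
    -- The shift is chosen so that the squared norm equals `‖v‖²` plus `s² - 1` times this product,
    -- up to the constants `(s² - 1) r` and `s² * cutShift d ^ 2`.
    have hcap : (⟪a, v⟫_ℝ - r) * (⟪a, v⟫_ℝ + 1) ≤ 0 :=
      mul_nonpos_of_nonpos_of_nonneg (by linarith) (by linarith)
    nlinarith [mul_nonneg hl (neg_nonneg.2 hcap)]
  · rw [map_smul, smul_inv_smul₀ hρ.ne', axisScale_axisScale (inv_mul_cancel₀ hs.ne') ha]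
    abel

/-- The ellipsoid with center `c` and linear map `A`. -/
def ellipsoid (c : E) (A : E →L[ℝ] E) : Set E :=
  (fun v => c + A v) '' Metric.closedBall 0 1

theorem mem_ellipsoid {c : E} {A : E →L[ℝ] E} {y : E} :
    y ∈ ellipsoid c A ↔ ∃ v, ‖v‖ ≤ 1 ∧ c + A v = y := by
  simp [ellipsoid]

variable [CompleteSpace E]

/-- The unit normal, in the coordinates given by `A`, of the cut with gradient `g`. -/
def cutNormal (A : E →L[ℝ] E) (g : E) : E :=
  ‖ContinuousLinearMap.adjoint A g‖⁻¹ • ContinuousLinearMap.adjoint A g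

/-- The center of the ellipsoid obtained from `c + A • ball` by a shallow cut with gradient `g`. -/
def cutCenter (d : ℕ) (c : E) (A : E →L[ℝ] E) (g : E) : E :=
  c - cutShift d • A (cutNormal A g)

/-- The linear map of the ellipsoid obtained from `c + A • ball` by a shallow cut with
gradient `g`. -/
def cutMap (d : ℕ) (A : E →L[ℝ] E) (g : E) : E →L[ℝ] E :=
  cutScale d • A.comp (axisScale (cutRatio d)⁻¹ (cutNormal A g))

/-- If a point in the shallow part of an ellipsoid around a sublevel set violates the sublevel
condition, then its gradient cuts down the ellipsoid. -/
theorem sublevel_subset_ellipsoid_cut {d : ℕ} (hd : 2 ≤ d) {f : E → ℝ}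
    (hf : ConvexOn ℝ Set.univ f) (hdiff : Differentiable ℝ f) {m : ℝ} {c u : E} {A : E →L[ℝ] E}
    (hsub : {y | f y ≤ m} ⊆ ellipsoid c A) (hu : ‖u‖ ≤ cutDepth d) (hfu : m < f (c + A u))
    (hne : {y | f y ≤ m}.Nonempty) :
    ‖cutNormal A (gradient f (c + A u))‖ = 1 ∧ {y | f y ≤ m} ⊆
      ellipsoid (cutCenter d c A (gradient f (c + A u))) (cutMap d A (gradient f (c + A u))) := by
  set g := gradient f (c + A u) with hg
  -- The tangent plane at the violating point separates it strictly from the sublevel set; the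
  -- adjoint moves this half-space to the coordinates of the ellipsoid.
  have hcut : ∀ v, f (c + A v) ≤ m → ⟪ContinuousLinearMap.adjoint A g, v⟫_ℝ <
      ⟪ContinuousLinearMap.adjoint A g, u⟫_ℝ := by
    intro v hv
    have h := hf.add_inner_gradient_le (hdiff (c + A u)) (c + A v)
    rw [← hg, add_sub_add_left_eq_sub, ← map_sub, ← ContinuousLinearMap.adjoint_inner_left,
      inner_sub_right] at h
    linarith
  have hpos : 0 < ‖ContinuousLinearMap.adjoint A g‖ := by
    obtain ⟨y, hy⟩ := hne
    obtain ⟨v, -, rfl⟩ := mem_ellipsoid.1 (hsub hy)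
    have := hcut v hy
    rw [norm_pos_iff]
    intro h0
    simp [h0] at this
  have hunit : ‖cutNormal A g‖ = 1 := by
    rw [cutNormal, norm_smul, norm_inv, norm_norm, inv_mul_cancel₀ hpos.ne']
  refine ⟨hunit, fun y hy => ?_⟩
  obtain ⟨v, hv, rfl⟩ := mem_ellipsoid.1 (hsub hy)
  -- The cut passes through `u`, not the center, but the short `u` keeps it shallow.
  have hle : ⟪cutNormal A g, v⟫_ℝ ≤ cutDepth d := by
    have h1 : ⟪cutNormal A g, v⟫_ℝ ≤ ⟪cutNormal A g, u⟫_ℝ := by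
      simp only [cutNormal, real_inner_smul_left]
      exact mul_le_mul_of_nonneg_left (hcut v hy).le (by positivity)
    have h2 := real_inner_le_norm (cutNormal A g) u
    rw [hunit, one_mul] at h2
    linarith
  obtain ⟨w, hw, hvw⟩ := exists_of_mem_cap hd hunit hv hle
  refine mem_ellipsoid.2 ⟨w, hw, ?_⟩
  conv_rhs => rw [hvw]
  simp only [cutCenter, cutMap, map_add, map_neg, map_smul, smul_apply,
    ContinuousLinearMap.comp_apply]
  abel

theorem det_cutMap {d : ℕ} {A : EuclideanSpace ℝ (Fin d) →L[ℝ] EuclideanSpace ℝ (Fin d)}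
    {g : EuclideanSpace ℝ (Fin d)} (h : ‖cutNormal A g‖ = 1) :
    (cutMap d A g).det = cutContraction d * A.det := by
  rw [cutMap, ContinuousLinearMap.det, ContinuousLinearMap.toLinearMap_smul, LinearMap.det_smul,
    ContinuousLinearMap.toLinearMap_comp, LinearMap.det_comp, det_axisScale _ h,
    finrank_euclideanSpace_fin, cutContraction, ContinuousLinearMap.det]
  ring

theorem measurable_cutNormal [FiniteDimensional ℝ E] [MeasurableSpace E] [BorelSpace E] :
    Measurable fun p : (E →L[ℝ] E) × E => cutNormal p.1 p.2 := by
  have : Continuous fun p : (E →L[ℝ] E) × E => ContinuousLinearMap.adjoint p.1 p.2 := by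
    fun_prop
  have := this.measurable
  unfold cutNormal
  fun_prop

theorem measurable_cutCenter [FiniteDimensional ℝ E] [MeasurableSpace E] [BorelSpace E] (d : ℕ) :
    Measurable fun p : E × (E →L[ℝ] E) × E => cutCenter d p.1 p.2.1 p.2.2 := by
  have h1 : Continuous fun p : (E →L[ℝ] E) × E => p.1 p.2 := by fun_prop
  have h2 : Measurable fun p : E × (E →L[ℝ] E) × E => cutNormal p.2.1 p.2.2 :=
    measurable_cutNormal.comp measurable_snd
  exact measurable_fst.sub
    ((h1.measurable.comp ((measurable_fst.comp measurable_snd).prodMk h2)).const_smul _)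

theorem measurable_cutMap [FiniteDimensional ℝ E] [MeasurableSpace E] [BorelSpace E] (d : ℕ) :
    Measurable fun p : (E →L[ℝ] E) × E => cutMap d p.1 p.2 := by
  have h1 : Continuous fun p : (E →L[ℝ] E) × E =>
      cutScale d • p.1.comp (axisScale (cutRatio d)⁻¹ p.2) := by
    unfold axisScale
    fun_prop
  exact h1.measurable.comp (measurable_fst.prodMk measurable_cutNormal)

end ShallowCut

/-! ### Rounding the sublevel set -/

noncomputable section Rounding

variable {d : ℕ} {κ : ℝ} {V : EuclideanSpace ℝ (Fin d) → ℝ}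

/-- The vertices `±cutDepth d • eᵢ` of a cross-polytope, enumerated by `j < 2 * d`. -/
def testPoint (d j : ℕ) : EuclideanSpace ℝ (Fin d) :=
  if h : j / 2 < d then
    EuclideanSpace.single ⟨j / 2, h⟩ (if Even j then cutDepth d else -cutDepth d)
  -- Queried only when all `2 * d` tests have succeeded; the answer is then ignored.
  else 0

theorem cutDepth_nonneg (d : ℕ) : 0 ≤ cutDepth d := by unfold cutDepth; positivity

theorem norm_testPoint_le (d j : ℕ) : ‖testPoint d j‖ ≤ cutDepth d := by
  have := cutDepth_nonneg d
  unfold testPoint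
  split_ifs <;> simp [abs_of_nonneg this, this]

/-- A convex set that contains the test points contains a ball. -/
theorem closedBall_subset_of_testPoint_mem (hd : 0 < d) {K : Set (EuclideanSpace ℝ (Fin d))}
    (hK : Convex ℝ K) (h : ∀ j < 2 * d, testPoint d j ∈ K) :
    Metric.closedBall 0 (cutDepth d / d) ⊆ K := by
  intro v hv
  rw [mem_closedBall_zero_iff] at hv
  have hd' : (0 : ℝ) < d := by exact_mod_cast hd
  have hr : 0 < cutDepth d := by unfold cutDepth; positivity
  have hcoord : ∀ i : Fin d, EuclideanSpace.single i (d * v i) ∈ K := by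
    intro i
    have h1 : EuclideanSpace.single i (cutDepth d) ∈ K := by
      have := h (2 * i) (by have := i.2; omega)
      simpa [testPoint] using this
    have h2 : EuclideanSpace.single i (-cutDepth d) ∈ K := by
      have := h (2 * i + 1) (by have := i.2; omega)
      have hdiv : (2 * (i : ℕ) + 1) / 2 = i := by omega
      simpa [testPoint, hdiv] using this
    have hvi : |d * v i| ≤ cutDepth d := by
      rw [abs_mul, abs_of_pos hd', ← le_div_iff₀' hd']
      exact (PiLp.norm_apply_le v i).trans hv
    rw [abs_le] at hvi
    have hmem := hK h2 h1 (a := (cutDepth d - d * v i) / (2 * cutDepth d))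
      (b := (cutDepth d + d * v i) / (2 * cutDepth d))
      (div_nonneg (by linarith) (by linarith)) (div_nonneg (by linarith) (by linarith))
      (by field_simp; ring)
    convert hmem using 1
    ext k
    by_cases hk : k = i
    · subst hk; simp; field_simp; ring
    · simp [hk]
  -- `v` is the average of the points `d * v i` on the axes, each between two opposite vertices.
  have hsum : ∑ i : Fin d, (1 / (d : ℝ)) • EuclideanSpace.single i (d * v i) ∈ K :=
    hK.sum_mem (fun _ _ => by positivity) (by simp [hd'.ne']) (fun i _ => hcoord i)
  convert hsum using 1
  ext k
  simp [Pi.single_apply, hd'.ne']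

/-- The state of the rounding procedure: the center and the linear map of an ellipsoid, and the
number of consecutive test points that were found to be in the sublevel set. -/
abbrev RoundingState (d : ℕ) : Type :=
  EuclideanSpace ℝ (Fin d) × (EuclideanSpace ℝ (Fin d) →L[ℝ] EuclideanSpace ℝ (Fin d)) × ℕ

/-- The next query of the rounding procedure. -/
def roundingQuery (R : RoundingState d) : EuclideanSpace ℝ (Fin d) :=
  R.1 + R.2.1 (testPoint d R.2.2)

/-- The update of the rounding procedure for the level `v₀ + 1`, given an oracle answer. -/
def roundingStep (v₀ : ℝ) (R : RoundingState d) (ans : ℝ × EuclideanSpace ℝ (Fin d)) :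
    RoundingState d :=
  if R.2.2 < 2 * d then
    if ans.1 ≤ v₀ + 1 then (R.1, R.2.1, R.2.2 + 1)
    else (cutCenter d R.1 R.2.1 ans.2, cutMap d R.2.1 ans.2, 0)
  else R

/-- The initial ellipsoid is the ball of radius `2`. -/
def roundingInit (d : ℕ) : RoundingState d :=
  (0, (2 : ℝ) • ContinuousLinearMap.id ℝ _, 0)

/-- The state of the rounding procedure after `k` queries to the oracle of `V`. -/
def roundingState (V : EuclideanSpace ℝ (Fin d) → ℝ) : ℕ → RoundingState d
  | 0 => roundingInit d
  | k + 1 => roundingStep (V 0) (roundingState V k)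
      (firstOrderOracle V (roundingQuery (roundingState V k)))

theorem measurable_roundingQuery : Measurable (roundingQuery (d := d)) := by
  have h1 : Continuous fun p : (EuclideanSpace ℝ (Fin d) →L[ℝ] EuclideanSpace ℝ (Fin d)) ×
      EuclideanSpace ℝ (Fin d) => p.1 p.2 := by fun_prop
  have h2 : Measurable (testPoint d) := measurable_from_top
  unfold roundingQuery
  exact measurable_fst.add (h1.measurable.comp (f := fun R : RoundingState d =>
    (R.2.1, testPoint d R.2.2)) (by fun_prop))

theorem measurable_roundingStep : Measurable fun p : ℝ × RoundingState d ×
    (ℝ × EuclideanSpace ℝ (Fin d)) => roundingStep p.1 p.2.1 p.2.2 := by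
  have h1 := (measurable_cutCenter (E := EuclideanSpace ℝ (Fin d)) d).comp
    (f := fun p : ℝ × RoundingState d × (ℝ × EuclideanSpace ℝ (Fin d)) =>
      (p.2.1.1, p.2.1.2.1, p.2.2.2)) (by fun_prop)
  have h2 := (measurable_cutMap (E := EuclideanSpace ℝ (Fin d)) d).comp
    (f := fun p : ℝ × RoundingState d × (ℝ × EuclideanSpace ℝ (Fin d)) =>
      (p.2.1.2.1, p.2.2.2)) (by fun_prop)
  unfold roundingStep
  refine Measurable.ite ?_ (Measurable.ite ?_ ?_ ?_) ?_
  · exact measurableSet_lt (by fun_prop) (by fun_prop)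
  · exact measurableSet_le (by fun_prop) (by fun_prop)
  · have : Measurable fun j : ℕ => j + 1 := measurable_from_top
    fun_prop
  · exact h1.prodMk (h2.prodMk measurable_const)
  · fun_prop

/-- The invariant of the rounding procedure after `k` queries. -/
structure RoundingInvariant (V : EuclideanSpace ℝ (Fin d) → ℝ) (k : ℕ) (R : RoundingState d) :
    Prop where
  subset_ellipsoid : {y | V y ≤ V 0 + 1} ⊆ ellipsoid R.1 R.2.1
  test_le : ∀ j < R.2.2, V (R.1 + R.2.1 (testPoint d j)) ≤ V 0 + 1
  count_le : R.2.2 ≤ 2 * d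
  progress : ∃ n : ℕ, |R.2.1.det| ≤ 2 ^ d * cutContraction d ^ n ∧
    (R.2.2 = 2 * d ∨ k ≤ 2 * d * n + R.2.2)

/-- In `progress`, `n` counts the cuts. A cut comes after fewer than `2 * d` successful tests, so
with its own query it accounts for at most `2 * d` queries. -/
theorem roundingInvariant_roundingState (hd : 2 ≤ d) (hV : IsAdmissiblePotential κ V) (k : ℕ) :
    RoundingInvariant V k (roundingState V k) := by
  induction k with
  | zero =>
    refine ⟨fun y hy => mem_ellipsoid.2 ⟨(2 : ℝ)⁻¹ • y, ?_, ?_⟩, ?_, ?_, 0, ?_, ?_⟩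
    · have h1 := hV.le_sub y
      have h2 : V y ≤ V 0 + 1 := hy
      rw [norm_smul]
      norm_num
      nlinarith [norm_nonneg y]
    · simp [roundingState, roundingInit]
    · simp [roundingState, roundingInit]
    · simp [roundingState, roundingInit]
    · simp [roundingState, roundingInit, ContinuousLinearMap.det]
    · simp [roundingState, roundingInit]
  | succ k ih =>
    rw [roundingState]
    set R := roundingState V k
    obtain ⟨hsub, htest, hcount, n, hn, hprog⟩ := ih
    unfold roundingStep
    by_cases hj : R.2.2 < 2 * d
    · have hprog' : k ≤ 2 * d * n + R.2.2 := hprog.resolve_left hj.ne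
      rw [if_pos hj]
      by_cases hle : (firstOrderOracle V (roundingQuery R)).1 ≤ V 0 + 1
      · rw [if_pos hle]
        refine ⟨hsub, fun j hj' => ?_, hj, n, hn, Or.inr ?_⟩
        · rcases Nat.lt_succ_iff_lt_or_eq.1 hj' with h | h
          · exact htest j h
          · rw [h]; exact hle
        · change k + 1 ≤ 2 * d * n + (R.2.2 + 1); omega
      · rw [if_neg hle]
        obtain ⟨hunit, hsub'⟩ := sublevel_subset_ellipsoid_cut hd hV.convexOn hV.differentiable
          hsub (norm_testPoint_le d R.2.2) (not_le.1 hle) ⟨0, by simp⟩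
        refine ⟨hsub', fun j hj' => absurd hj' (Nat.not_lt_zero j), Nat.zero_le _, n + 1, ?_,
          Or.inr ?_⟩
        · change |(cutMap d R.2.1 (gradient V (R.1 + R.2.1 (testPoint d R.2.2)))).det| ≤ _
          rw [det_cutMap hunit, abs_mul, abs_of_pos (cutContraction_pos d), pow_succ]
          nlinarith [mul_le_mul_of_nonneg_left hn (cutContraction_pos d).le]
        · change k + 1 ≤ 2 * d * (n + 1) + 0
          rw [Nat.mul_succ]; omega
    · rw [if_neg hj]
      exact ⟨hsub, htest, hcount, n, hn, Or.inl (le_antisymm hcount (not_lt.1 hj))⟩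

/-- Comparison of volumes. This lower bound on the determinant limits the number of cuts. -/
theorem pow_le_abs_det_of_closedBall_subset {c : EuclideanSpace ℝ (Fin d)}
    {A : EuclideanSpace ℝ (Fin d) →L[ℝ] EuclideanSpace ℝ (Fin d)} {ρ : ℝ} (hρ : 0 ≤ ρ)
    (h : Metric.closedBall 0 ρ ⊆ ellipsoid c A) : ρ ^ d ≤ |A.det| := by
  have himage : ellipsoid c A = (fun x => c + x) '' (A '' Metric.closedBall 0 1) := by
    rw [ellipsoid, Set.image_image]
  have h1 := measure_mono (μ := volume) h
  rw [himage, Set.image_add_left, measure_preimage_add, Measure.addHaar_image_continuousLinearMap,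
    Measure.addHaar_closedBall _ _ hρ, finrank_euclideanSpace_fin,
    Measure.addHaar_unitClosedBall_eq_addHaar_unitBall] at h1
  have h2 := (ENNReal.mul_le_mul_iff_left (Metric.measure_ball_pos volume _ one_pos).ne'
    measure_ball_lt_top.ne).1 h1
  exact (ENNReal.ofReal_le_ofReal_iff (abs_nonneg _)).1 h2

/-- The affine map `v ↦ c + A v` brings the sublevel set `{V ≤ V 0 + 1}` into a position between
two concentric balls. -/
structure IsRounding (V : EuclideanSpace ℝ (Fin d) → ℝ) (c : EuclideanSpace ℝ (Fin d))
    (A : EuclideanSpace ℝ (Fin d) →L[ℝ] EuclideanSpace ℝ (Fin d)) : Prop where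
  subset_ellipsoid : {y | V y ≤ V 0 + 1} ⊆ ellipsoid c A
  le_of_norm_le : ∀ v, ‖v‖ ≤ cutDepth d / d → V (c + A v) ≤ V 0 + 1
  det_ne_zero : A.det ≠ 0

/-- If the tests were unfinished after `2 * d * (F + 1)` queries, at least `F` cuts would have
occurred, and the ellipsoid would be too small to contain the ball of radius `κ^(-1/2)`. -/
theorem isRounding_roundingState (hd : 2 ≤ d) (hκ : 1 ≤ κ) {F : ℕ}
    (hF : 2 ^ d * cutContraction d ^ F < (√κ)⁻¹ ^ d) (hV : IsAdmissiblePotential κ V) :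
    IsRounding V (roundingState V (2 * d * (F + 1))).1
      (roundingState V (2 * d * (F + 1))).2.1 := by
  obtain ⟨hsub, htest, hcount, n, hn, hprog⟩ :=
    roundingInvariant_roundingState hd hV (2 * d * (F + 1))
  set R := roundingState V (2 * d * (F + 1))
  have hκ0 : 0 < κ := by linarith
  have hball : Metric.closedBall 0 (√κ)⁻¹ ⊆ {y | V y ≤ V 0 + 1} := by
    intro y hy
    rw [mem_closedBall_zero_iff] at hy
    have h1 := hV.sub_le y
    have h2 : ‖y‖ ^ 2 ≤ κ⁻¹ := by
      calc ‖y‖ ^ 2 ≤ (√κ)⁻¹ ^ 2 := pow_le_pow_left₀ (norm_nonneg y) hy 2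
        _ = κ⁻¹ := by rw [inv_pow, Real.sq_sqrt hκ0.le]
    have h3 : κ * ‖y‖ ^ 2 ≤ 1 :=
      (mul_le_mul_of_nonneg_left h2 hκ0.le).trans_eq (mul_inv_cancel₀ hκ0.ne')
    show V y ≤ V 0 + 1
    linarith
  have hdet : (√κ)⁻¹ ^ d ≤ |R.2.1.det| :=
    pow_le_abs_det_of_closedBall_subset (by positivity) (hball.trans hsub)
  have hcount_eq : R.2.2 = 2 * d := by
    refine hprog.resolve_right fun hlt => ?_
    have hnF : F ≤ n := by
      by_contra! hlt'
      have h1 : 2 * d * (n + 1) ≤ 2 * d * F := Nat.mul_le_mul_left _ hlt'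
      rw [Nat.mul_succ] at h1 hlt
      omega
    have := pow_le_pow_of_le_one (cutContraction_pos d).le (cutContraction_lt_one hd).le hnF
    have h2 := mul_le_mul_of_nonneg_left this (by positivity : (0 : ℝ) ≤ 2 ^ d)
    linarith
  refine ⟨hsub, fun v hv => ?_, fun h0 => ?_⟩
  · have hconv : Convex ℝ {v | V (R.1 + R.2.1 v) ≤ V 0 + 1} := by
      have h1 := (hV.convexOn.translate_right R.1).comp_linearMap R.2.1.toLinearMap
      simpa using h1.convex_le (V 0 + 1)
    exact closedBall_subset_of_testPoint_mem (by omega) hconv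
      (fun j hj => htest j (hcount_eq ▸ hj)) (mem_closedBall_zero_iff.2 hv)
  · rw [h0, abs_zero] at hdet
    exact absurd hdet (not_le.2 (by positivity))

end Rounding

/-! ### Rejection sampling -/

noncomputable section Rejection

/-- One trial of rejection sampling: keep a point that was accepted before, otherwise accept the
proposed point `x` if `acc` holds. -/
def rejectionStep {E : Type*} [Zero E] (acc : Prop) [Decidable acc] (x : E) (s : Bool × E) :
    Bool × E :=
  if s.1 then s else if acc then (true, x) else (false, 0)

open Classical in
/-- The state of rejection sampling after `n` trials with proposals `ω i`, acceptance set `S` and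
output map `φ`. -/
def rejectionState {Z E : Type*} [Zero E] (S : Set Z) (φ : Z → E) (ω : ℕ → Z) : ℕ → Bool × E
  | 0 => (false, 0)
  | n + 1 => rejectionStep (ω n ∈ S) (φ (ω n)) (rejectionState S φ ω n)

theorem rejectionState_of_forall_notMem {Z E : Type*} [Zero E] {S : Set Z} {φ : Z → E}
    {ω : ℕ → Z} {n : ℕ} (h : ∀ i < n, ω i ∉ S) : rejectionState S φ ω n = (false, 0) := by
  induction n with
  | zero => rfl
  | succ n ih =>
    rw [rejectionState, ih fun i hi => h i (hi.trans n.lt_succ_self), rejectionStep]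
    simp [h n n.lt_succ_self]

theorem rejectionState_of_mem {Z E : Type*} [Zero E] {S : Set Z} {φ : Z → E}
    {ω : ℕ → Z} {k n : ℕ} (h : ∀ i < k, ω i ∉ S) (hk : ω k ∈ S) (hkn : k < n) :
    rejectionState S φ ω n = (true, φ (ω k)) := by
  induction n, hkn using Nat.le_induction with
  | base =>
    rw [rejectionState, rejectionState_of_forall_notMem h, rejectionStep]
    simp [hk]
  | succ n _ ih =>
    rw [rejectionState, ih, rejectionStep]
    simp

/-- If a single trial outputs an accepted point with law proportional to `π`, then the output of
`n` independent trials is close to `π`. -/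
theorem rejectionState_mul_le_measureReal {Z E : Type*} [MeasurableSpace Z] [MeasurableSpace E]
    [Zero E] {ν : Measure Z} [IsProbabilityMeasure ν] {π : Measure E} [IsProbabilityMeasure π]
    {A : Set Z} (hA : MeasurableSet A) {φ : Z → E} (hφ : Measurable φ)
    (hprop : ∀ S, MeasurableSet S → ν.real (A ∩ φ ⁻¹' S) = ν.real A * π.real S)
    {α : ℝ} (hα : α ≤ ν.real A) (n : ℕ) {S : Set E} (hS : MeasurableSet S) :
    (1 - (1 - α) ^ n) * π.real S ≤
      (Measure.infinitePi fun _ : ℕ => ν).real {ω | (rejectionState A φ ω n).2 ∈ S} := by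
  set P := Measure.infinitePi fun _ : ℕ => ν
  let t : ℕ → ℕ → Set Z := fun k i => if i < k then Aᶜ else A ∩ φ ⁻¹' S
  have ht : ∀ k i, MeasurableSet (t k i) := fun k i => by
    simp only [t]; split_ifs
    exacts [hA.compl, hA.inter (hφ hS)]
  -- The event that trial `k` is the first accepted one and its output lies in `S`. These events are
  -- disjoint, and their probabilities form a geometric sum.
  let D : ℕ → Set (ℕ → Z) := fun k => Set.pi (Finset.range (k + 1)) (t k)
  have hD : ∀ k, MeasurableSet (D k) := fun k =>
    MeasurableSet.pi (Finset.countable_toSet _) fun i _ => ht k i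
  have hD_mem : ∀ {k ω}, ω ∈ D k → (∀ i < k, ω i ∉ A) ∧ ω k ∈ A ∧ φ (ω k) ∈ S := by
    intro k ω hω
    have hω' : ∀ i < k + 1, ω i ∈ t k i := fun i hi => hω i (by simpa using hi)
    refine ⟨fun i hi => ?_, ?_⟩
    · simpa [t, hi] using hω' i (hi.trans k.lt_succ_self)
    · simpa [t] using hω' k k.lt_succ_self
  have hD_meas : ∀ k, P.real (D k) = (1 - ν.real A) ^ k * (ν.real A * π.real S) := by
    intro k
    have h1 : P (D k) = ∏ i ∈ Finset.range (k + 1), ν (t k i) :=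
      Measure.infinitePi_pi _ fun i _ => ht k i
    rw [measureReal_def, h1, ENNReal.toReal_prod, Finset.prod_range_succ]
    congr 1
    · rw [Finset.prod_congr rfl (g := fun _ => 1 - ν.real A), Finset.prod_const,
        Finset.card_range]
      intro i hi
      simp only [t, Finset.mem_range.1 hi, if_true]
      rw [← probReal_compl_eq_one_sub hA]; rfl
    · simp only [t, lt_irrefl, if_false]
      exact hprop S hS
  have hdisj : (Finset.range n : Set ℕ).PairwiseDisjoint D := by
    have key : ∀ i j, i < j → Disjoint (D i) (D j) := fun i j hij =>
      Set.disjoint_left.2 fun ω hi hj => (hD_mem hj).1 i hij (hD_mem hi).2.1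
    intro i _ j _ hij
    rcases lt_or_gt_of_ne hij with h | h
    exacts [key i j h, (key j i h).symm]
  have hsub : (⋃ k ∈ Finset.range n, D k) ⊆ {ω | (rejectionState A φ ω n).2 ∈ S} := by
    intro ω hω
    simp only [Set.mem_iUnion, Finset.mem_range] at hω
    obtain ⟨k, hk, hω⟩ := hω
    obtain ⟨h1, h2, h3⟩ := hD_mem hω
    rw [Set.mem_ofPred_eq, rejectionState_of_mem h1 h2 hk]
    exact h3
  have hunion := measureReal_mono (μ := P) hsub
  rw [measureReal_biUnion_finset hdisj (fun k _ => hD k), Finset.sum_congr rfl fun k _ => hD_meas k,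
    ← Finset.sum_mul] at hunion
  have hgeom := geom_sum_mul (1 - ν.real A) n
  have hpow : (1 - ν.real A) ^ n ≤ (1 - α) ^ n :=
    pow_le_pow_left₀ (by linarith [measureReal_le_one (μ := ν) (s := A)]) (by linarith) n
  refine le_trans ?_ hunion
  rw [← mul_assoc]
  refine mul_le_mul_of_nonneg_right ?_ measureReal_nonneg
  linarith

end Rejection

/-! ### Proposal law and acceptance probability -/

noncomputable section Proposal

variable {d : ℕ} {κ : ℝ} {V : EuclideanSpace ℝ (Fin d) → ℝ}

theorem integrable_exp_neg_norm_div (d : ℕ) :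
    Integrable fun u : EuclideanSpace ℝ (Fin d) => Real.exp (-‖u‖ / 3) := by
  have h1 : Integrable fun u : EuclideanSpace ℝ (Fin d) => (1 + ‖u‖) ^ (-((d + 1 : ℕ) : ℝ)) :=
    integrable_one_add_norm (by simp)
  refine (h1.const_mul (Real.exp 3⁻¹ * ((d + 1).factorial * 3 ^ (d + 1)))).mono'
    (by fun_prop) (Filter.Eventually.of_forall fun u => ?_)
  have hu : 0 ≤ ‖u‖ := norm_nonneg u
  rw [Real.norm_of_nonneg (Real.exp_pos _).le, Real.rpow_neg (by positivity), Real.rpow_natCast,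
    ← div_eq_mul_inv, le_div_iff₀ (by positivity)]
  have h2 := Real.pow_div_factorial_le_exp ((1 + ‖u‖) / 3) (by positivity) (d + 1)
  rw [div_pow, div_div, div_le_iff₀ (by positivity)] at h2
  have h3 : Real.exp (-‖u‖ / 3) * Real.exp ((1 + ‖u‖) / 3) = Real.exp 3⁻¹ := by
    rw [← Real.exp_add]; congr 1; ring
  calc Real.exp (-‖u‖ / 3) * (1 + ‖u‖) ^ (d + 1)
      ≤ Real.exp (-‖u‖ / 3) * (Real.exp ((1 + ‖u‖) / 3) * (3 ^ (d + 1) * (d + 1).factorial)) :=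
        mul_le_mul_of_nonneg_left h2 (Real.exp_pos _).le
    _ = _ := by rw [← mul_assoc, h3]; ring

theorem integrable_exp_neg_of_sq_le {f : EuclideanSpace ℝ (Fin d) → ℝ} (hf : Measurable f)
    {b : ℝ} (h : ∀ x, ‖x‖ ^ 2 / 2 + b ≤ f x) : Integrable fun x => Real.exp (-f x) := by
  refine ((integrable_exp_neg_norm_div d).const_mul (Real.exp (1 - b))).mono'
    (by fun_prop) (Filter.Eventually.of_forall fun x => ?_)
  rw [Real.norm_of_nonneg (Real.exp_pos _).le, ← Real.exp_add, Real.exp_le_exp]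
  nlinarith [h x, sq_nonneg (‖x‖ - 1)]

namespace IsAdmissiblePotential

theorem integrable_exp_neg (hV : IsAdmissiblePotential κ V) :
    Integrable fun x => Real.exp (-V x) :=
  integrable_exp_neg_of_sq_le hV.continuous.measurable (b := V 0)
    fun x => by linarith [hV.le_sub x]

theorem isProbabilityMeasure_targetMeasure (hV : IsAdmissiblePotential κ V) :
    IsProbabilityMeasure (targetMeasure V) :=
  isProbabilityMeasure_tilted hV.integrable_exp_neg

end IsAdmissiblePotential

/-- The law of the proposals, in the coordinates of the rounding. -/
def proposalLaw (d : ℕ) : Measure (EuclideanSpace ℝ (Fin d)) :=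
  (volume : Measure (EuclideanSpace ℝ (Fin d))).tilted (fun u => -‖u‖ / 3)

instance (d : ℕ) : IsProbabilityMeasure (proposalLaw d) :=
  isProbabilityMeasure_tilted (integrable_exp_neg_norm_div d)

/-- The law of a proposal together with a uniform random number. -/
def trialLaw (d : ℕ) : Measure (EuclideanSpace ℝ (Fin d) × unitInterval) :=
  (proposalLaw d).prod volume

instance (d : ℕ) : IsProbabilityMeasure (trialLaw d) := by unfold trialLaw; infer_instance

/-- The probability of accepting the proposal `u` when the potential exceeds its minimum
by `w`. -/
def acceptProb (w : ℝ) (u : EuclideanSpace ℝ (Fin d)) : ℝ := Real.exp (‖u‖ / 3 - 2 - w)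

/-- The trials that are accepted. -/
def acceptSet (V : EuclideanSpace ℝ (Fin d) → ℝ) (c : EuclideanSpace ℝ (Fin d))
    (A : EuclideanSpace ℝ (Fin d) →L[ℝ] EuclideanSpace ℝ (Fin d)) :
    Set (EuclideanSpace ℝ (Fin d) × unitInterval) :=
  {z | (z.2 : ℝ) ≤ acceptProb (V (c + A z.1) - V 0) z.1}

/-- A lower bound for the probability of acceptance. -/
def acceptBound (d : ℕ) : ℝ :=
  Real.exp (-3) * (proposalLaw d).real (Metric.closedBall 0 (cutDepth d / d))

theorem acceptBound_pos (hd : 0 < d) : 0 < acceptBound d := by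
  have hr : 0 < cutDepth d / d := by unfold cutDepth; positivity
  refine mul_pos (Real.exp_pos _) (ENNReal.toReal_pos ?_ (measure_ne_top _ _))
  have hac : (volume : Measure (EuclideanSpace ℝ (Fin d))) ≪ proposalLaw d :=
    absolutelyContinuous_tilted (integrable_exp_neg_norm_div d)
  exact fun h0 => (Metric.measure_closedBall_pos volume (0 : EuclideanSpace ℝ (Fin d)) hr).ne'
    (hac h0)

theorem acceptBound_lt_one (d : ℕ) : acceptBound d < 1 := by
  have h1 : Real.exp (-3) < 1 := by simp
  have h2 : (proposalLaw d).real (Metric.closedBall 0 (cutDepth d / d)) ≤ 1 := measureReal_le_one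
  have h3 : 0 ≤ (proposalLaw d).real (Metric.closedBall 0 (cutDepth d / d)) := measureReal_nonneg
  unfold acceptBound
  nlinarith [Real.exp_pos (-3)]

namespace IsRounding

variable {c : EuclideanSpace ℝ (Fin d)}
  {A : EuclideanSpace ℝ (Fin d) →L[ℝ] EuclideanSpace ℝ (Fin d)}

/-- After rounding, a convex potential grows at a linear rate. -/
theorem norm_div_sub_le (h : IsRounding V c A) (hV : IsAdmissiblePotential κ V)
    (u : EuclideanSpace ℝ (Fin d)) : ‖u‖ / 3 - 2 ≤ V (c + A u) - V 0 := by
  obtain ⟨u₀, hu₀, hcu₀⟩ := mem_ellipsoid.1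
    (h.subset_ellipsoid (show V 0 ≤ V 0 + 1 by linarith))
  have hnorm : ‖u‖ ≤ ‖u - u₀‖ + 1 := by
    have := norm_add_le (u - u₀) u₀
    rw [sub_add_cancel] at this
    linarith
  rcases le_or_gt ‖u - u₀‖ 3 with hle | hgt
  · linarith [hV.minimized_at_zero (c + A u)]
  have hpos : 0 < ‖u - u₀‖ := by linarith
  -- At distance `3` from the coordinates `u₀` of the minimizer, the point `p` has norm greater than
  -- `1`, so it is outside the ellipsoid and `V` has risen by more than `1` there. Convexity extends
  -- this slope `1/3` to `u`.
  set t : ℝ := 3 / ‖u - u₀‖ with ht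
  have ht0 : 0 < t := by positivity
  have ht1 : t < 1 := (div_lt_one hpos).2 hgt
  have htu : t * ‖u - u₀‖ = 3 := div_mul_cancel₀ 3 hpos.ne'
  set p := u₀ + t • (u - u₀) with hp
  have hp_norm : 1 < ‖p‖ := by
    have h1 : ‖t • (u - u₀)‖ = 3 := by rw [norm_smul, Real.norm_of_nonneg ht0.le, htu]
    have h2 := norm_sub_le p u₀
    rw [hp, add_sub_cancel_left, h1] at h2
    linarith
  have hinj : Function.Injective A :=
    (LinearMap.equivOfDetNeZero A.toLinearMap h.det_ne_zero).injective
  have hVp : V 0 + 1 < V (c + A p) := by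
    by_contra! hle
    obtain ⟨q, hq, hcq⟩ := mem_ellipsoid.1 (h.subset_ellipsoid hle)
    rw [hinj (add_left_cancel hcq)] at hq
    linarith
  have hconv := hV.convexOn.2 (Set.mem_univ (c + A u₀)) (Set.mem_univ (c + A u))
    (sub_nonneg.2 ht1.le) ht0.le (by ring)
  have hpt : (1 - t) • (c + A u₀) + t • (c + A u) = c + A p := by
    rw [hp, map_add, map_smul, map_sub]
    module
  rw [hpt, hcu₀, smul_eq_mul, smul_eq_mul] at hconv
  have h1 : 1 ≤ t * (V (c + A u) - V 0) := by linarith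
  have h2 : ‖u - u₀‖ ≤ 3 * (V (c + A u) - V 0) := by
    rw [← htu]; nlinarith
  linarith

theorem measurable_acceptProb (hV : IsAdmissiblePotential κ V) :
    Measurable fun u => acceptProb (V (c + A u) - V 0) u := by
  have := hV.continuous.measurable
  unfold acceptProb
  fun_prop

theorem measurableSet_acceptSet (hV : IsAdmissiblePotential κ V) :
    MeasurableSet (acceptSet V c A) :=
  measurableSet_le (by fun_prop) ((measurable_acceptProb hV).comp measurable_fst)

/-- Integrate out the uniform variable. Linear growth makes `acceptProb` at most `1`, so it is
exactly the measure of the slice. -/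
theorem trialLaw_acceptSet_inter (h : IsRounding V c A) (hV : IsAdmissiblePotential κ V)
    {S : Set (EuclideanSpace ℝ (Fin d))} (hS : MeasurableSet S) :
    trialLaw d (acceptSet V c A ∩ (fun z => c + A z.1) ⁻¹' S) =
      ∫⁻ u in (fun u => c + A u) ⁻¹' S,
        ENNReal.ofReal (acceptProb (V (c + A u) - V 0) u) ∂(proposalLaw d) := by
  have hφ : Measurable fun u => c + A u := by fun_prop
  have hpre : MeasurableSet ((fun z : EuclideanSpace ℝ (Fin d) × unitInterval => c + A z.1) ⁻¹' S) :=
    (hφ.comp measurable_fst) hS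
  rw [trialLaw, Measure.prod_apply ((measurableSet_acceptSet hV).inter hpre), ← lintegral_indicator (hφ hS)]
  refine lintegral_congr fun u => ?_
  by_cases hu : c + A u ∈ S
  · have hmem : u ∈ (fun u => c + A u) ⁻¹' S := hu
    rw [Set.indicator_of_mem hmem]
    have h0 : 0 ≤ acceptProb (V (c + A u) - V 0) u := (Real.exp_pos _).le
    have h1 : acceptProb (V (c + A u) - V 0) u ≤ 1 := by
      rw [acceptProb, Real.exp_le_one_iff]
      linarith [h.norm_div_sub_le hV u]
    have : Prod.mk u ⁻¹' (acceptSet V c A ∩ (fun z => c + A z.1) ⁻¹' S) =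
        Set.Iic (⟨acceptProb (V (c + A u) - V 0) u, h0, h1⟩ : unitInterval) := by
      ext t
      simp [acceptSet, hu, ← Subtype.coe_le_coe]
    rw [this, unitInterval.volume_Iic]
  · have hmem : u ∉ (fun u => c + A u) ⁻¹' S := hu
    rw [Set.indicator_of_notMem hmem]
    have : Prod.mk u ⁻¹' (acceptSet V c A ∩ (fun z => c + A z.1) ⁻¹' S) = ∅ := by
      ext t; simp [hu]
    rw [this, measure_empty]

/-- The factor `exp (‖u‖ / 3)` in `acceptProb` cancels the proposal density and leaves a multiple of
`exp (-V)`; the affine change of variables adds only a determinant. The algorithm never needs the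
value of `K`. -/
theorem exists_trialLaw_acceptSet_inter_eq (h : IsRounding V c A)
    (hV : IsAdmissiblePotential κ V) : ∃ K : ENNReal, ∀ S, MeasurableSet S →
      trialLaw d (acceptSet V c A ∩ (fun z => c + A z.1) ⁻¹' S) = K * targetMeasure V S := by
  have hφ : Measurable fun u => c + A u := by fun_prop
  have hVm := hV.continuous.measurable
  set Z₁ := ∫ u : EuclideanSpace ℝ (Fin d), Real.exp (-‖u‖ / 3) with hZ₁
  set Z := ∫ x, Real.exp (-V x) with hZ
  have hZ₁pos : 0 < Z₁ := integral_exp_pos (integrable_exp_neg_norm_div d)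
  have hZpos : 0 < Z := integral_exp_pos hV.integrable_exp_neg
  have hmap : Measure.map (fun u => c + A u) volume = ENNReal.ofReal |A.det⁻¹| • volume := by
    have h1 := Measure.map_linearMap_addHaar_eq_smul_addHaar
      (volume : Measure (EuclideanSpace ℝ (Fin d))) (f := A.toLinearMap) h.det_ne_zero
    have h2 : Measure.map (fun u => c + A u) volume =
        Measure.map (fun x => c + x) (Measure.map A volume) :=
      (Measure.map_map (measurable_const_add c) A.continuous.measurable).symm
    rw [h2]
    change Measure.map _ (Measure.map A.toLinearMap volume) = _
    rw [h1, Measure.map_smul, map_add_left_eq_self]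
  refine ⟨ENNReal.ofReal (Real.exp (V 0 - 2) * Z / Z₁) * ENNReal.ofReal |A.det⁻¹|, fun S hS => ?_⟩
  rw [h.trialLaw_acceptSet_inter hV hS, proposalLaw, setLIntegral_tilted, targetMeasure,
    tilted_apply, ← hZ₁, ← hZ]
  calc ∫⁻ u in (fun u => c + A u) ⁻¹' S, ENNReal.ofReal (Real.exp (-‖u‖ / 3) / Z₁) *
        ENNReal.ofReal (acceptProb (V (c + A u) - V 0) u)
      = ∫⁻ u in (fun u => c + A u) ⁻¹' S, ENNReal.ofReal (Real.exp (V 0 - 2) * Z / Z₁) *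
          ENNReal.ofReal (Real.exp (-V (c + A u)) / Z) := by
        refine lintegral_congr fun u => ?_
        rw [← ENNReal.ofReal_mul (by positivity), ← ENNReal.ofReal_mul (by positivity)]
        congr 1
        have e1 : Real.exp (-‖u‖ / 3) * acceptProb (V (c + A u) - V 0) u =
            Real.exp (V 0 - 2) * Real.exp (-V (c + A u)) := by
          rw [acceptProb, ← Real.exp_add, ← Real.exp_add]; congr 1; ring
        rw [div_mul_eq_mul_div, e1]
        field_simp
    _ = ENNReal.ofReal (Real.exp (V 0 - 2) * Z / Z₁) *
          ∫⁻ x in S, ENNReal.ofReal (Real.exp (-V x) / Z) ∂(Measure.map (fun u => c + A u)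
            volume) := by
        rw [lintegral_const_mul _ (by fun_prop), setLIntegral_map hS (by fun_prop) hφ]
    _ = _ := by
        rw [hmap, Measure.restrict_smul, lintegral_smul_measure, smul_eq_mul, mul_assoc]

theorem trialLaw_real_acceptSet_inter (h : IsRounding V c A) (hV : IsAdmissiblePotential κ V)
    (S : Set (EuclideanSpace ℝ (Fin d))) (hS : MeasurableSet S) :
    (trialLaw d).real (acceptSet V c A ∩ (fun z => c + A z.1) ⁻¹' S) =
      (trialLaw d).real (acceptSet V c A) * (targetMeasure V).real S := by
  have := hV.isProbabilityMeasure_targetMeasure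
  obtain ⟨K, hK⟩ := h.exists_trialLaw_acceptSet_inter_eq hV
  have huniv := hK _ MeasurableSet.univ
  rw [Set.preimage_univ, Set.inter_univ, measure_univ, mul_one] at huniv
  rw [measureReal_def, hK S hS, ENNReal.toReal_mul, ← huniv]
  rfl

/-- On the inner ball of the rounding `V - V 0 ≤ 1`, so the acceptance probability is at least `exp
(-2 - 1)`, whatever `κ` is. -/
theorem acceptBound_le (h : IsRounding V c A) (hV : IsAdmissiblePotential κ V) :
    acceptBound d ≤ (trialLaw d).real (acceptSet V c A) := by
  have h1 := h.trialLaw_acceptSet_inter hV MeasurableSet.univ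
  rw [Set.preimage_univ, Set.inter_univ, Set.preimage_univ, Measure.restrict_univ] at h1
  set B := Metric.closedBall (0 : EuclideanSpace ℝ (Fin d)) (cutDepth d / d)
  have h2 : ENNReal.ofReal (Real.exp (-3)) * proposalLaw d B ≤ trialLaw d (acceptSet V c A) := by
    rw [h1, ← setLIntegral_const]
    refine (setLIntegral_mono' Metric.isClosed_closedBall.measurableSet fun u hu => ?_).trans
      (setLIntegral_le_lintegral _ _)
    refine ENNReal.ofReal_le_ofReal (Real.exp_le_exp.2 ?_)
    have := h.le_of_norm_le u (mem_closedBall_zero_iff.1 hu)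
    linarith [norm_nonneg u]
  have h3 := ENNReal.toReal_mono (measure_ne_top _ _) h2
  rwa [ENNReal.toReal_mul, ENNReal.toReal_ofReal (Real.exp_pos _).le] at h3

end IsRounding

end Proposal

/-! ### Stateful procedures as query algorithms -/

noncomputable section StateMachine

namespace QueryAlgorithm

variable {d : ℕ} {Ω S : Type} [MeasurableSpace Ω] [MeasurableSpace S]

/-- The state of a state machine with initial state `init` and update rule `upd`, as a function of
the seed and the oracle's answers. -/
def machineState (init : S) (upd : ℕ → Ω × S × (ℝ × EuclideanSpace ℝ (Fin d)) → S) :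
    (k : ℕ) → Ω × (Fin k → ℝ × EuclideanSpace ℝ (Fin d)) → S
  | 0, _ => init
  | k + 1, p => upd k (p.1, machineState init upd k (p.1, fun i => p.2 i.castSucc),
      p.2 (Fin.last k))

theorem measurable_machineState (init : S)
    {upd : ℕ → Ω × S × (ℝ × EuclideanSpace ℝ (Fin d)) → S} (hupd : ∀ k, Measurable (upd k))
    (k : ℕ) : Measurable (machineState init upd k) := by
  induction k with
  | zero => exact measurable_const
  | succ k ih =>
    refine (hupd k).comp (measurable_fst.prodMk (Measurable.prodMk (ih.comp ?_) ?_))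
    · fun_prop
    · fun_prop

/-- The query algorithm that is described by a state machine. -/
def ofStateMachine (P : Measure Ω) [IsProbabilityMeasure P] (n : ℕ) (init : S)
    (qry : ℕ → Ω × S → EuclideanSpace ℝ (Fin d)) (hqry : ∀ k, Measurable (qry k))
    (upd : ℕ → Ω × S × (ℝ × EuclideanSpace ℝ (Fin d)) → S) (hupd : ∀ k, Measurable (upd k))
    (out : S → EuclideanSpace ℝ (Fin d)) (hout : Measurable out) : QueryAlgorithm d where
  Seed := Ω
  seedLaw := P
  numQueries := n
  query k p := qry k (p.1, machineState init upd k p)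
  measurable_query k :=
    (hqry k).comp (measurable_fst.prodMk (measurable_machineState init hupd k))
  output p := out (machineState init upd n p)
  measurable_output := hout.comp (measurable_machineState init hupd n)

/-- The state of the state machine when it interacts with the oracle of `V`. -/
def trajectory (init : S) (qry : ℕ → Ω × S → EuclideanSpace ℝ (Fin d))
    (upd : ℕ → Ω × S × (ℝ × EuclideanSpace ℝ (Fin d)) → S) (V : EuclideanSpace ℝ (Fin d) → ℝ)
    (ω : Ω) : ℕ → S
  | 0 => init
  | k + 1 => upd k (ω, trajectory init qry upd V ω k,
      firstOrderOracle V (qry k (ω, trajectory init qry upd V ω k)))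

variable (P : Measure Ω) [IsProbabilityMeasure P] (n : ℕ) (init : S)
    {qry : ℕ → Ω × S → EuclideanSpace ℝ (Fin d)} (hqry : ∀ k, Measurable (qry k))
    {upd : ℕ → Ω × S × (ℝ × EuclideanSpace ℝ (Fin d)) → S} (hupd : ∀ k, Measurable (upd k))
    {out : S → EuclideanSpace ℝ (Fin d)} (hout : Measurable out)

theorem machineState_answers (V : EuclideanSpace ℝ (Fin d) → ℝ) (ω : Ω) (k : ℕ) :
    machineState init upd k
      (ω, (ofStateMachine P n init qry hqry upd hupd out hout).answers V ω k) =
      trajectory init qry upd V ω k := by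
  induction k with
  | zero => rfl
  | succ k ih =>
    rw [trajectory, machineState, ← ih]
    simp only [answers, Fin.snoc_castSucc, Fin.snoc_last]
    rfl

theorem run_ofStateMachine (V : EuclideanSpace ℝ (Fin d) → ℝ) (ω : Ω) :
    (ofStateMachine P n init qry hqry upd hupd out hout).run V ω =
      out (trajectory init qry upd V ω n) := by
  rw [← machineState_answers P n init hqry hupd hout]
  rfl

theorem measurable_trajectory (hqry : ∀ k, Measurable (qry k)) (hupd : ∀ k, Measurable (upd k))
    {V : EuclideanSpace ℝ (Fin d) → ℝ} (hV : Measurable (firstOrderOracle V)) (k : ℕ) :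
    Measurable fun ω => trajectory init qry upd V ω k := by
  induction k with
  | zero => exact measurable_const
  | succ k ih =>
    exact (hupd k).comp (measurable_id.prodMk
      (ih.prodMk (hV.comp ((hqry k).comp (measurable_id.prodMk ih)))))

end QueryAlgorithm

end StateMachine

/-! ### The sampler and its error -/

noncomputable section Sampler

variable {d : ℕ} {κ : ℝ} {V : EuclideanSpace ℝ (Fin d) → ℝ}

theorem IsAdmissiblePotential.measurable_firstOrderOracle (hV : IsAdmissiblePotential κ V) :
    Measurable (firstOrderOracle V) :=
  hV.continuous.measurable.prodMk hV.continuous_gradient.measurable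

/-- The randomness of the sampler: a sequence of trials. -/
abbrev SamplerSeed (d : ℕ) : Type := ℕ → EuclideanSpace ℝ (Fin d) × unitInterval

/-- The state of the sampler: the minimal value of the potential, the state of the rounding
procedure, and the state of rejection sampling. -/
abbrev SamplerState (d : ℕ) : Type := ℝ × RoundingState d × (Bool × EuclideanSpace ℝ (Fin d))

/-- The sampler first queries the origin, then makes `T` queries for the rounding, and then queries
one proposal after the other. -/
def samplerQuery (d T k : ℕ) (p : SamplerSeed d × SamplerState d) : EuclideanSpace ℝ (Fin d) :=
  if k = 0 then 0
  else if k ≤ T then roundingQuery p.2.2.1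
  else p.2.2.1.1 + p.2.2.1.2.1 (p.1 (k - (T + 1))).1

/-- The rejection step of the sampler. -/
def samplerTrial (v₀ : ℝ) (R : RoundingState d) (z : EuclideanSpace ℝ (Fin d) × unitInterval)
    (v : ℝ) (s : Bool × EuclideanSpace ℝ (Fin d)) : Bool × EuclideanSpace ℝ (Fin d) :=
  rejectionStep ((z.2 : ℝ) ≤ acceptProb (v - v₀) z.1) (R.1 + R.2.1 z.1) s

/-- The update of the state of the sampler after an oracle answer. -/
def samplerUpdate (d T k : ℕ)
    (p : SamplerSeed d × SamplerState d × (ℝ × EuclideanSpace ℝ (Fin d))) : SamplerState d :=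
  if k = 0 then (p.2.2.1, p.2.1.2)
  else if k ≤ T then (p.2.1.1, roundingStep p.2.1.1 p.2.1.2.1 p.2.2, p.2.1.2.2)
  else (p.2.1.1, p.2.1.2.1,
    samplerTrial p.2.1.1 p.2.1.2.1 (p.1 (k - (T + 1))) p.2.2.1 p.2.1.2.2)

/-- The initial state of the sampler. -/
def samplerInit (d : ℕ) : SamplerState d := (0, roundingInit d, (false, 0))

theorem measurable_apply_proposal : Measurable fun p : RoundingState d × EuclideanSpace ℝ (Fin d) =>
    p.1.1 + p.1.2.1 p.2 := by
  have h1 : Continuous fun p : (EuclideanSpace ℝ (Fin d) →L[ℝ] EuclideanSpace ℝ (Fin d)) ×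
      EuclideanSpace ℝ (Fin d) => p.1 p.2 := by fun_prop
  exact (measurable_fst.comp measurable_fst).add (h1.measurable.comp
    (f := fun p : RoundingState d × EuclideanSpace ℝ (Fin d) => (p.1.2.1, p.2)) (by fun_prop))

theorem measurable_samplerQuery (T k : ℕ) : Measurable (samplerQuery d T k) := by
  unfold samplerQuery
  split_ifs
  · exact measurable_const
  · exact measurable_roundingQuery.comp (by fun_prop)
  · exact measurable_apply_proposal.comp
      (f := fun p : SamplerSeed d × SamplerState d => (p.2.2.1, (p.1 (k - (T + 1))).1))
      (by fun_prop)

theorem measurable_samplerTrial : Measurable fun p : ℝ × RoundingState d ×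
    (EuclideanSpace ℝ (Fin d) × unitInterval) × ℝ × (Bool × EuclideanSpace ℝ (Fin d)) =>
    samplerTrial p.1 p.2.1 p.2.2.1 p.2.2.2.1 p.2.2.2.2 := by
  unfold samplerTrial rejectionStep
  refine Measurable.ite ?_ (by fun_prop) (Measurable.ite ?_ ?_ (by fun_prop))
  · exact measurableSet_eq_fun (by fun_prop) (by fun_prop)
  · unfold acceptProb
    exact measurableSet_le (by fun_prop) (by fun_prop)
  · exact measurable_const.prodMk (measurable_apply_proposal.comp
      (f := fun p : ℝ × RoundingState d × (EuclideanSpace ℝ (Fin d) × unitInterval) × ℝ ×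
        (Bool × EuclideanSpace ℝ (Fin d)) => (p.2.1, p.2.2.1.1)) (by fun_prop))

theorem measurable_samplerUpdate (T k : ℕ) : Measurable (samplerUpdate d T k) := by
  unfold samplerUpdate
  split_ifs
  · fun_prop
  · have h := (measurable_roundingStep (d := d)).comp
      (f := fun p : SamplerSeed d × SamplerState d × (ℝ × EuclideanSpace ℝ (Fin d)) =>
        (p.2.1.1, p.2.1.2.1, p.2.2)) (by fun_prop)
    exact Measurable.prodMk (by fun_prop) (h.prodMk (by fun_prop))
  · have h := (measurable_samplerTrial (d := d)).comp
      (f := fun p : SamplerSeed d × SamplerState d × (ℝ × EuclideanSpace ℝ (Fin d)) =>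
        (p.2.1.1, p.2.1.2.1, p.1 (k - (T + 1)), p.2.2.1, p.2.1.2.2)) (by fun_prop)
    exact Measurable.prodMk (by fun_prop) (Measurable.prodMk (by fun_prop) h)

/-- The sampling algorithm with `T` rounding queries and `N` trials of rejection sampling. -/
def sampler (d T N : ℕ) : QueryAlgorithm d :=
  QueryAlgorithm.ofStateMachine (Measure.infinitePi fun _ : ℕ => trialLaw d) (T + 1 + N)
    (samplerInit d) (samplerQuery d T) (measurable_samplerQuery T) (samplerUpdate d T)
    (measurable_samplerUpdate T) (fun s => s.2.2.2) (by fun_prop)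

/-- The index is shifted by one because query `0` is spent on learning `V 0`. -/
theorem trajectory_rounding (V : EuclideanSpace ℝ (Fin d) → ℝ) (T : ℕ) (ω : SamplerSeed d)
    {k : ℕ} (hk : k ≤ T) :
    QueryAlgorithm.trajectory (samplerInit d) (samplerQuery d T) (samplerUpdate d T) V ω (k + 1) =
      (V 0, roundingState V k, (false, 0)) := by
  induction k with
  | zero => simp [QueryAlgorithm.trajectory, samplerUpdate, samplerQuery, samplerInit,
      roundingState, firstOrderOracle]
  | succ k ih =>
    rw [QueryAlgorithm.trajectory, ih (by omega)]
    simp [samplerUpdate, samplerQuery, hk, roundingState]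

theorem trajectory_rejection (V : EuclideanSpace ℝ (Fin d) → ℝ) (T : ℕ) (ω : SamplerSeed d)
    (m : ℕ) :
    QueryAlgorithm.trajectory (samplerInit d) (samplerQuery d T) (samplerUpdate d T) V ω
      (T + 1 + m) =
      (V 0, roundingState V T,
        rejectionState (acceptSet V (roundingState V T).1 (roundingState V T).2.1)
          (fun z => (roundingState V T).1 + (roundingState V T).2.1 z.1) ω m) := by
  induction m with
  | zero => exact trajectory_rounding V T ω le_rfl
  | succ m ih =>
    rw [← add_assoc, QueryAlgorithm.trajectory, ih]
    have h1 : ¬ T + 1 + m ≤ T := by omega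
    simp [samplerUpdate, samplerQuery, h1, rejectionState, samplerTrial, firstOrderOracle,
      acceptSet, rejectionStep]
    congr

theorem run_sampler (V : EuclideanSpace ℝ (Fin d) → ℝ) (T N : ℕ) (ω : SamplerSeed d) :
    (sampler d T N).run V ω =
      (QueryAlgorithm.trajectory (samplerInit d) (samplerQuery d T) (samplerUpdate d T) V ω
        (T + 1 + N)).2.2.2 :=
  QueryAlgorithm.run_ofStateMachine (Measure.infinitePi fun _ : ℕ => trialLaw d) (T + 1 + N)
    (samplerInit d) (measurable_samplerQuery T) (measurable_samplerUpdate T) (by fun_prop) V ω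

theorem tvDistance_sampler_le (hV : IsAdmissiblePotential κ V) {T : ℕ}
    (hround : IsRounding V (roundingState V T).1 (roundingState V T).2.1) (N : ℕ) :
    tvDistance ((sampler d T N).outputLaw V) (targetMeasure V) ≤ (1 - acceptBound d) ^ N := by
  have := hV.isProbabilityMeasure_targetMeasure
  have hrun : (sampler d T N).run V = fun ω =>
      (QueryAlgorithm.trajectory (samplerInit d) (samplerQuery d T) (samplerUpdate d T) V ω
        (T + 1 + N)).2.2.2 :=
    funext fun ω => run_sampler V T N ω
  have hmeas : Measurable ((sampler d T N).run V) := by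
    rw [hrun]
    have := QueryAlgorithm.measurable_trajectory (samplerInit d) (measurable_samplerQuery T)
      (measurable_samplerUpdate T) hV.measurable_firstOrderOracle (T + 1 + N)
    exact measurable_snd.comp (measurable_snd.comp (measurable_snd.comp this))
  have : IsProbabilityMeasure ((sampler d T N).outputLaw V) :=
    Measure.isProbabilityMeasure_map hmeas.aemeasurable
  refine tvDistance_le_of_mul_le fun S hS => ?_
  have h := rejectionState_mul_le_measureReal (IsRounding.measurableSet_acceptSet hV)
    (by fun_prop) (hround.trialLaw_real_acceptSet_inter hV) (hround.acceptBound_le hV) N hS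
  rw [QueryAlgorithm.outputLaw, map_measureReal_apply hmeas hS, hrun]
  simp only [trajectory_rejection]
  exact h

/-! ### Small condition number without queries -/

/-- A law that approximates all targets with small condition number. -/
def gaussianLaw (d : ℕ) : Measure (EuclideanSpace ℝ (Fin d)) :=
  (volume : Measure (EuclideanSpace ℝ (Fin d))).tilted (fun x => -(2 * ‖x‖ ^ 2))

theorem integrable_exp_neg_two_mul_sq (d : ℕ) :
    Integrable fun x : EuclideanSpace ℝ (Fin d) => Real.exp (-(2 * ‖x‖ ^ 2)) :=
  integrable_exp_neg_of_sq_le (by fun_prop) (b := 0) fun x => by nlinarith [sq_nonneg ‖x‖]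

instance (d : ℕ) : IsProbabilityMeasure (gaussianLaw d) :=
  isProbabilityMeasure_tilted (integrable_exp_neg_two_mul_sq d)

/-- The algorithm that makes no queries. -/
def noQueryAlgorithm (d : ℕ) : QueryAlgorithm d where
  Seed := EuclideanSpace ℝ (Fin d)
  seedLaw := gaussianLaw d
  numQueries := 0
  query _ _ := 0
  measurable_query _ := measurable_const
  output p := p.1
  measurable_output := measurable_fst

/-- For `κ ≤ 2`, `‖x‖² / 2 ≤ V x - V 0 ≤ 2 ‖x‖²`, so the target density is at least `Z₁ / Z₂` times
the Gaussian density. -/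
theorem exists_tvDistance_noQueryAlgorithm_le (d : ℕ) : ∃ c : ℝ, 0 < c ∧ c < 1 ∧
    ∀ (κ : ℝ) (V : EuclideanSpace ℝ (Fin d) → ℝ), κ ≤ 2 → IsAdmissiblePotential κ V →
      tvDistance ((noQueryAlgorithm d).outputLaw V) (targetMeasure V) ≤ 1 - c := by
  set Z₁ := ∫ x : EuclideanSpace ℝ (Fin d), Real.exp (-(2 * ‖x‖ ^ 2)) with hZ₁
  set Z₂ := ∫ x : EuclideanSpace ℝ (Fin d), Real.exp (-(‖x‖ ^ 2 / 2)) with hZ₂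
  have hint₂ : Integrable fun x : EuclideanSpace ℝ (Fin d) => Real.exp (-(‖x‖ ^ 2 / 2)) :=
    integrable_exp_neg_of_sq_le (by fun_prop) (b := 0) fun x => by simp
  have h₁ : 0 < Z₁ := integral_exp_pos (integrable_exp_neg_two_mul_sq d)
  have h₂ : 0 < Z₂ := integral_exp_pos hint₂
  refine ⟨min (Z₁ / Z₂) (1 / 2), by positivity, (min_le_right _ _).trans_lt (by norm_num),
    fun κ V hκ hV => ?_⟩
  have := hV.isProbabilityMeasure_targetMeasure
  have hlaw : (noQueryAlgorithm d).outputLaw V = gaussianLaw d := Measure.map_id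
  rw [hlaw, tvDistance_comm]
  refine tvDistance_le_of_mul_le fun S hS => ?_
  rw [sub_sub_cancel]
  refine (mul_le_mul_of_nonneg_right (min_le_left _ _) measureReal_nonneg).trans ?_
  set Z := ∫ x, Real.exp (-V x) with hZ
  have hZpos : 0 < Z := integral_exp_pos hV.integrable_exp_neg
  have hZle : Z ≤ Real.exp (-V 0) * Z₂ := by
    rw [hZ, hZ₂, ← integral_const_mul]
    refine integral_mono hV.integrable_exp_neg (hint₂.const_mul _) fun x => ?_
    simp only [← Real.exp_add, Real.exp_le_exp]
    linarith [hV.le_sub x]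
  have hpoint : ∀ x, Z₁ / Z₂ * (Real.exp (-(2 * ‖x‖ ^ 2)) / Z₁) ≤ Real.exp (-V x) / Z := by
    intro x
    have h3 : Real.exp (-V 0) * Real.exp (-(2 * ‖x‖ ^ 2)) ≤ Real.exp (-V x) := by
      rw [← Real.exp_add, Real.exp_le_exp]
      nlinarith [hV.sub_le x, sq_nonneg ‖x‖]
    have h4 : Z₁ / Z₂ * (Real.exp (-(2 * ‖x‖ ^ 2)) / Z₁) = Real.exp (-(2 * ‖x‖ ^ 2)) / Z₂ := by
      field_simp
    rw [h4, div_le_div_iff₀ h₂ hZpos]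
    calc Real.exp (-(2 * ‖x‖ ^ 2)) * Z ≤ Real.exp (-(2 * ‖x‖ ^ 2)) * (Real.exp (-V 0) * Z₂) :=
          mul_le_mul_of_nonneg_left hZle (Real.exp_pos _).le
      _ = (Real.exp (-V 0) * Real.exp (-(2 * ‖x‖ ^ 2))) * Z₂ := by ring
      _ ≤ _ := mul_le_mul_of_nonneg_right h3 h₂.le
  have hle : ENNReal.ofReal (Z₁ / Z₂) * gaussianLaw d S ≤ targetMeasure V S := by
    rw [gaussianLaw, targetMeasure, tilted_apply, tilted_apply, ← hZ₁, ← hZ,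
      ← lintegral_const_mul' _ _ ENNReal.ofReal_ne_top]
    refine lintegral_mono fun x => ?_
    rw [← ENNReal.ofReal_mul (by positivity)]
    exact ENNReal.ofReal_le_ofReal (hpoint x)
  have := ENNReal.toReal_mono (measure_ne_top _ _) hle
  rwa [ENNReal.toReal_mul, ENNReal.toReal_ofReal (by positivity)] at this

/-- The number of cuts and trials that suffice for condition number `κ` and accuracy `ε`. -/
theorem exists_sampler_parameters (hd : 2 ≤ d) {κ ε : ℝ} (hκ : 1 ≤ κ) (hε : 0 < ε) (hε1 : ε < 1) :
    ∃ F N : ℕ, 2 ^ d * cutContraction d ^ F < (√κ)⁻¹ ^ d ∧ (1 - acceptBound d) ^ N ≤ ε ∧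
      (F : ℝ) ≤ (d * Real.log 2 + d / 2 * Real.log κ) / -Real.log (cutContraction d) + 1 ∧
      (N : ℝ) ≤ Real.log (1 / ε) / acceptBound d + 1 := by
  have hθ := cutContraction_pos d
  have hα := acceptBound_pos (d := d) (by omega)
  have hL : 0 < -Real.log (cutContraction d) :=
    neg_pos.2 (Real.log_neg hθ (cutContraction_lt_one hd))
  have hlogκ : 0 ≤ Real.log κ := Real.log_nonneg hκ
  have hlogε : 0 ≤ Real.log (1 / ε) := Real.log_nonneg (by rw [le_div_iff₀ hε]; linarith)
  set X := d * Real.log 2 + d / 2 * Real.log κ with hX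
  have hX0 : 0 ≤ X := by have := Real.log_nonneg one_le_two; positivity
  -- Floor plus one, not ceiling, because the volume inequality must be strict.
  refine ⟨⌊X / -Real.log (cutContraction d)⌋₊ + 1, ⌈Real.log (1 / ε) / acceptBound d⌉₊, ?_, ?_, ?_,
    (Nat.ceil_lt_add_one (by positivity)).le⟩
  · have h1 := Nat.lt_floor_add_one (X / -Real.log (cutContraction d))
    rw [div_lt_iff₀ hL] at h1
    have hκ0 : 0 < κ := by linarith
    rw [← Real.log_lt_log_iff (by positivity) (by positivity), Real.log_mul (by positivity)
      (by positivity), Real.log_pow, Real.log_pow, Real.log_pow, Real.log_inv, Real.log_sqrt hκ0.le]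
    push_cast
    linarith
  · calc (1 - acceptBound d) ^ ⌈Real.log (1 / ε) / acceptBound d⌉₊
        ≤ Real.exp (-acceptBound d) ^ ⌈Real.log (1 / ε) / acceptBound d⌉₊ :=
          pow_le_pow_left₀ (by linarith [acceptBound_lt_one d])
            (by linarith [Real.add_one_le_exp (-acceptBound d)]) _
      _ ≤ Real.exp (-Real.log (1 / ε)) := by
          rw [← Real.exp_nat_mul, Real.exp_le_exp]
          have h1 := Nat.le_ceil (Real.log (1 / ε) / acceptBound d)
          rw [div_le_iff₀ hα] at h1
          linarith
      _ = ε := by rw [one_div, Real.log_inv, neg_neg, Real.exp_log hε]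
  · push_cast
    linarith [Nat.floor_le (div_nonneg hX0 hL.le)]

end Sampler

/-! ### Query count -/

theorem mainTheorem8 (d : ℕ) (hd : 2 ≤ d) :
    ∃ (C : ℝ) (p : ℕ), ∀ κ : ℝ, 1 ≤ κ → ∀ ε : ℝ, 0 < ε → ε < 1 →
      ∃ alg : QueryAlgorithm d,
        (alg.numQueries : ℝ) ≤ C * (Real.log κ + Real.log (1 / ε) ^ p) ∧
        ∀ V : EuclideanSpace ℝ (Fin d) → ℝ, IsAdmissiblePotential κ V →
          tvDistance (alg.outputLaw V) (targetMeasure V) ≤ ε := by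
  obtain ⟨c, hc0, hc1, hc⟩ := exists_tvDistance_noQueryAlgorithm_le d
  have hα := acceptBound_pos (d := d) (by omega)
  have hL : 0 < -Real.log (cutContraction d) :=
    neg_pos.2 (Real.log_neg (cutContraction_pos d) (cutContraction_lt_one hd))
  set L := -Real.log (cutContraction d)
  set α := acceptBound d
  -- A lower bound for `log κ + log (1/ε)` whenever the query-free algorithm does not apply.
  set m := min (Real.log 2) (-Real.log (1 - c))
  have hlog2 : 0 < Real.log 2 := Real.log_pos one_lt_two
  have hm : 0 < m :=
    lt_min hlog2 (neg_pos.2 (Real.log_neg (by linarith) (by linarith)))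
  -- The part of the query count independent of `κ` and `ε`; the coefficient `a / m` below absorbs
  -- it.
  set a : ℝ := 2 + 2 * d * (d * Real.log 2 / L + 2)
  have ha : 0 ≤ a := by positivity
  refine ⟨a / m + d ^ 2 / L + 1 / α, 1, fun κ hκ ε hε hε1 => ?_⟩
  have hlogκ : 0 ≤ Real.log κ := Real.log_nonneg hκ
  have hlogε : 0 ≤ Real.log (1 / ε) := Real.log_nonneg (by rw [le_div_iff₀ hε]; linarith)
  rw [pow_one]
  by_cases hcase : κ ≤ 2 ∧ 1 - c ≤ ε
  · refine ⟨noQueryAlgorithm d, ?_, fun V hV => (hc κ V hcase.1 hV).trans hcase.2⟩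
    change ((0 : ℕ) : ℝ) ≤ _
    rw [Nat.cast_zero]
    positivity
  have hlarge : m ≤ Real.log κ + Real.log (1 / ε) := by
    rcases not_and_or.1 hcase with h | h
    · have := Real.log_le_log two_pos (not_le.1 h).le
      linarith [min_le_left (Real.log 2) (-Real.log (1 - c))]
    · have := Real.log_le_log hε (not_le.1 h).le
      rw [one_div, Real.log_inv] at hlogε ⊢
      linarith [min_le_right (Real.log 2) (-Real.log (1 - c))]
  obtain ⟨F, N, hF, hN, hF_le, hN_le⟩ := exists_sampler_parameters hd hκ hε hε1
  refine ⟨sampler d (2 * d * (F + 1)) N, ?_, fun V hV =>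
    (tvDistance_sampler_le hV (isRounding_roundingState hd hκ hF hV) N).trans hN⟩
  change ((2 * d * (F + 1) + 1 + N : ℕ) : ℝ) ≤ _
  push_cast
  change (F : ℝ) ≤ _ / L + 1 at hF_le
  change (N : ℝ) ≤ _ / α + 1 at hN_le
  set x := Real.log κ
  set y := Real.log (1 / ε)
  have h1 : 2 * (d : ℝ) * (F + 1) ≤
      2 * d * ((d * Real.log 2 + d / 2 * x) / L + 1 + 1) :=
    mul_le_mul_of_nonneg_left (by linarith) (by positivity)
  have h2 : a ≤ a / m * (x + y) := by
    calc a = a / m * m := (div_mul_cancel₀ a hm.ne').symm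
      _ ≤ _ := mul_le_mul_of_nonneg_left hlarge (by positivity)
  have h3 : 2 * (d : ℝ) * ((d * Real.log 2 + d / 2 * x) / L + 1 + 1) + 1 + (y / α + 1) =
      a + d ^ 2 / L * x + 1 / α * y := by
    simp only [a]; ring
  have h4 : 0 ≤ (d : ℝ) ^ 2 / L * y := by positivity
  have h5 : 0 ≤ 1 / α * x := by positivity
  calc _ ≤ a + (d : ℝ) ^ 2 / L * x + 1 / α * y := by rw [← h3]; linarith
    _ ≤ _ := by rw [add_mul, add_mul, mul_add (_ / L), mul_add (1 / α)]; linarith
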